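/- Let $\Sigma$ be a finite alphabet. Let $\mathfrak{F}$ be a property of finite sequences of words over $\Sigma$. An $\mathfrak{F}$-factorisation of a word $w$ is a sequence $w_1,\ldots,w_n$ of nonempty words with the property $\mathfrak{F}$ such that $w=w_1\cdots w_n$. The property $\mathfrak{F}$ is *synchronising* if every word has exactly one $\mathfrak{F}$-factorisation and there exist $l,r\ge 0$ such that for all words $x,y$ with $\mathfrak{F}$-factorisations $x=x_1\cdots x_s$ and $y=y_1\cdots y_k$, where $y$ is a factor of $x$ and $k>l+r$, there are $l'\le l$, $r'\le r$ and $1\le p\le q\le s$ with $q-p+1=k-l'-r'$ such that - $x_p=y_{l'+1},\ x_{p+1}=y_{l'+2},\ \ldots,\ x_q=y_{k-r'}$; - $y_1\cdots y_{l'}$ is a suffix of $x_{\max(1,p-l)}\cdots x_{p-1}$; - $y_{k-r'+1}\cdots y_k$ is a prefix of $x_{q+1}\cdots x_{\min(s,q+r)}$. (For example, the factorisation of a word into its maximal blocks of a single letter is synchronising.) Consider quantifier-free formulas, that is, Boolean combinations of atoms. In $\mathrm{WE}+\mathrm{LEN}$ the atoms are word equations $s_1=s_2$, where $s_1,s_2$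 are words over the variables and $\Sigma$, and length constraints $\ell_1=\ell_2$, where $\ell_1,\ell_2$ have the form $k_0+k_1|t_1|+\cdots+k_m|t_m|$ with $k_i\in\mathbb{Z}$ and each $t_i$ a variable or a constant word. In $\mathrm{WE}+\mathrm{REG}$ the atoms are word equations and membership constraints $s\in R$, where $s$ is a word over the variables and $\Sigma$, and $R\subseteq\Sigma^*$ is regular. The language expressed by a variable $x$ in a formula $f$ is the set of all words $h(x)$, where $h$ ranges over the substitutions of words over $\Sigma$ for the variables that make $f$ true. **Lemma.** Let $\mathfrak{F}$ be synchronising, let $f$ be a formula, $x$ a variable, and $L$ the language expressed by $x$ in $f$. 1. If $f$ is a formula of $\mathrm{WE}+\mathrm{LEN}$, there exists $d$ (depending only on $\mathfrak{F},f,x$) such that for every $w\in L$ with $\mathfrak{F}$-factorisation $w=w_1\cdots w_n$: if the number of distinct words among the $w_i$ is greater than $d$, then there is an $i$ such that, for every word $u$ with $|u|=|w_i|$, the word obtained from $w_1\cdots w_n$ by replacing every factor $w_j$ equal to $w_i$ by $u$ belongs to $L$. 2. If $f$ is a formula of $\mathrm{WE}+\mathrm{REG}$, there exist $d,e$ (depending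 only on $\mathfrak{F},f,x$) such that for every $w\in L$ with $\mathfrak{F}$-factorisation $w=w_1\cdots w_n$: if the number of distinct words of length greater than $e$ among the $w_i$ is greater than $d$, then there are an $i$ with $|w_i|>e$ and a word $u$ with $|u|<|w_i|$ such that the word obtained from $w_1\cdots w_n$ by replacing every factor $w_j$ equal to $w_i$ by $u$ belongs to $L$. -/

import Mathlib

namespace WordTheory

/-! ### String terms, formulas and their semantics

The letters come from an alphabet `α`, words are lists of letters, and the string variables
are indexed by `ℕ`. -/

/-- Basic string terms: a variable or a constant word. -/
inductive BasicTerm (α : Type*) where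
  | var : ℕ → BasicTerm α
  | word : List α → BasicTerm α

/-- Extended string terms: words over the union of the variables and the alphabet. -/
abbrev ExtTerm (α : Type*) := List (ℕ ⊕ α)

/-- Length terms `k₀ + k₁|s₁| + ⋯ + kₙ|sₙ|` with integers `kᵢ` and basic string terms `sᵢ`. -/
structure LenTerm (α : Type*) where
  const : ℤ
  summands : List (ℤ × BasicTerm α)

/-- Quantifier-free formulas over language membership constraints, length constraints and word
equations. -/
inductive Formula (α : Type*) where
  | mem : ExtTerm α → Language α → Formula α
  | lenEq : LenTerm α → LenTerm α → Formula α
  | wordEq : ExtTerm α → ExtTerm α → Formula α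
  | not : Formula α → Formula α
  | and : Formula α → Formula α → Formula α
  | or : Formula α → Formula α → Formula α
  | imp : Formula α → Formula α → Formula α
  | iff : Formula α → Formula α → Formula α

variable {α : Type*}

/-- The value of a basic string term under the substitution `h`. -/
def BasicTerm.eval (h : ℕ → List α) : BasicTerm α → List α
  | .var x => h x
  | .word w => w

/-- The value of an extended string term: the morphism that extends `h` and fixes each letter. -/
def ExtTerm.eval (h : ℕ → List α) (s : ExtTerm α) : List α :=
  s.flatMap (Sum.elim h (fun a => [a]))

/-- The value of a length term. -/
def LenTerm.eval (h : ℕ → List α) (t : LenTerm α) : ℤ :=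
  t.const + (t.summands.map (fun ks => ks.1 * ((ks.2.eval h).length : ℤ))).sum

/-- Truth of a formula under the substitution `h`. -/
def Formula.Holds (h : ℕ → List α) : Formula α → Prop
  | .mem s L => ExtTerm.eval h s ∈ L
  | .lenEq t₁ t₂ => t₁.eval h = t₂.eval h
  | .wordEq s₁ s₂ => ExtTerm.eval h s₁ = ExtTerm.eval h s₂
  | .not f => ¬ f.Holds h
  | .and f g => f.Holds h ∧ g.Holds h
  | .or f g => f.Holds h ∨ g.Holds h
  | .imp f g => f.Holds h → g.Holds h
  | .iff f g => f.Holds h ↔ g.Holds h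

/-- The language expressed by the variable `x` in the formula `f`: all values that `x` takes
under substitutions that make `f` true. -/
def Formula.expressed (f : Formula α) (x : ℕ) : Language α :=
  {w | ∃ h : ℕ → List α, f.Holds h ∧ h x = w}

/-- The formulas of the theory `WE + LEN`: the atoms are word equations and length constraints. -/
def Formula.IsWELEN : Formula α → Prop
  | .mem _ _ => False
  | .lenEq _ _ => True
  | .wordEq _ _ => True
  | .not f => f.IsWELEN
  | .and f g => f.IsWELEN ∧ g.IsWELEN
  | .or f g => f.IsWELEN ∧ g.IsWELEN
  | .imp f g => f.IsWELEN ∧ g.IsWELEN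
  | .iff f g => f.IsWELEN ∧ g.IsWELEN

/-- The formulas of the theory `WE + REG`: the atoms are word equations and membership
constraints for regular languages. -/
def Formula.IsWEREG : Formula α → Prop
  | .mem _ L => L.IsRegular
  | .lenEq _ _ => False
  | .wordEq _ _ => True
  | .not f => f.IsWEREG
  | .and f g => f.IsWEREG ∧ g.IsWEREG
  | .or f g => f.IsWEREG ∧ g.IsWEREG
  | .imp f g => f.IsWEREG ∧ g.IsWEREG
  | .iff f g => f.IsWEREG ∧ g.IsWEREG

/-! ### Synchronising factorisations -/

/-- `ws` is an `𝔽`-factorisation of `w`: a factorisation of `w` into nonempty words that has the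
property `𝔽`. Here `𝔽` is a property of sequences of words, so that a condition on a factor may
refer to its place in the word, as in `w_i is a maximal block of one letter`; a condition `P` on
single words is the special case `fun ws => ∀ v ∈ ws, P v`. -/
def IsFactorisation (𝔽 : List (List α) → Prop) (w : List α) (ws : List (List α)) : Prop :=
  𝔽 ws ∧ ws.flatten = w ∧ [] ∉ ws

/-- `𝔽` is synchronising: every word has exactly one `𝔽`-factorisation, and there are `l`, `r`
such that, whenever `y` is a factor of `x` and its factorisation `ys` has more than `l + r` parts,
the factorisations of `x` and `y` share a nonempty sequence `M` of consecutive parts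
(`xs = A ++ M ++ B`, `ys = C ++ M ++ D`), where `C` has at most `l` and `D` at most `r` parts, the
word spelled by `C` is a suffix of the word spelled by the last `l` parts of `A`, and the word
spelled by `D` is a prefix of the word spelled by the first `r` parts of `B`. -/
structure IsSynchronising (𝔽 : List (List α) → Prop) : Prop where
  existsUnique : ∀ w : List α, ∃! ws, IsFactorisation 𝔽 w ws
  sync : ∃ l r : ℕ, ∀ (x y : List α) (xs ys : List (List α)),
    IsFactorisation 𝔽 x xs → IsFactorisation 𝔽 y ys → y <:+: x → l + r < ys.length →
    ∃ A B C D M : List (List α),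
      xs = A ++ M ++ B ∧ ys = C ++ M ++ D ∧ M ≠ [] ∧ C.length ≤ l ∧ D.length ≤ r ∧
      C.flatten <:+ (A.drop (A.length - l)).flatten ∧
      D.flatten <+: (B.take r).flatten

/-- The word obtained from the factorisation `ws` by putting `u` in place of every factor that
equals `v`. -/
def replaceFactor [DecidableEq α] (ws : List (List α)) (v u : List α) : List α :=
  (ws.map (fun z => if z = v then u else z)).flatten

end WordTheory

/-!
A formula has a fixed number of atoms, so it suffices to find, for each value of the variable, a
replacement "`u` for `v`" that can be applied to all variables at once and keeps the truth value of
every atom. If the replacement commutes with concatenation on the finitely many products that occur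
in the formula, it preserves word equations. It also preserves inequations, since `x ≠ y` is
witnessed by factorisations such as `x = p a z`, `y = p b z'` with letters `a ≠ b`
(`IsSyncParsing.exists_subst_ne`). Length constraints survive if `|u| = |v|`, and membership in
regular languages survives if `u` and `v` induce the same transitions of the automata; among the
words with given transitions there is one of bounded length.

So the replacement has to be almost a morphism: each identity `subst (y ++ z) = subst y ++ subst z`
may fail for a bounded number of words `v` only (`IsSyncParsing.subst_append`). This is what
synchronisation is for, but there are two obstacles. First, it does not say at which occurrence of
`y` in `x` the factorisations of `y` and `x` are aligned. If there are two letters, `x` can be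
padded by a long power of a suitable letter so that the occurrences in question become unique, and
going from `y` to `x` through padded words aligns the factorisations at every occurrence
(`IsSyncParsing.agree_extend_left`, `IsSyncParsing.agree_extend_right`). Secondly, it says nothing
about words with few factors. Therefore the replacement in `y` refers to the factorisation of
`W ++ y ++ W`, where `W` is a fixed word with many factors; for words that have many factors
themselves the padding makes no difference (`IsSyncParsing.subst_eq_replaceFactor`). If there is no
such `W`, the number of factors is bounded and the claim is vacuous for large `d`.

Over a single letter there is nothing to show for `WE + LEN`, as `|u| = |v|` implies `u = v`.
For `WE + REG`, word equations become linear equations between lengths, unary regular languages are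
ultimately periodic, and so the expressed language is semilinear and hence ultimately periodic
(`Formula.exists_period`); a factor can be shortened by a period.
-/

namespace WordTheory

section

variable {α : Type*}

/-! ### Restricting a factorisation to an interval of positions -/

/-- The factorisation of `w.drop i` induced by a factorisation of `w`: the first `i` letters are
removed, a factor that straddles position `i` is cut there, and factors that become empty
disappear. -/
def dropLetters : ℕ → List (List α) → List (List α)
  | _, [] => []
  | i, w :: ws => (if i < w.length then [w.drop i] else []) ++ dropLetters (i - w.length) ws

/-- The factorisation of `w.take i` induced by a factorisation of `w`. -/
def takeLetters : ℕ → List (List α) → List (List α)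
  | _, [] => []
  | i, w :: ws => (if 0 < i then [w.take i] else []) ++ takeLetters (i - w.length) ws

theorem dropLetters_append (i : ℕ) (xs ys : List (List α)) :
    dropLetters i (xs ++ ys) = dropLetters i xs ++ dropLetters (i - xs.flatten.length) ys := by
  induction xs generalizing i with
  | nil => simp [dropLetters]
  | cons w ws ih =>
    simp only [List.cons_append, dropLetters, ih, List.append_assoc, List.flatten_cons,
      List.length_append, Nat.sub_add_eq]

theorem takeLetters_append (i : ℕ) (xs ys : List (List α)) :
    takeLetters i (xs ++ ys) = takeLetters i xs ++ takeLetters (i - xs.flatten.length) ys := by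
  induction xs generalizing i with
  | nil => simp [takeLetters]
  | cons w ws ih =>
    simp only [List.cons_append, takeLetters, ih, List.append_assoc, List.flatten_cons,
      List.length_append, Nat.sub_add_eq]

theorem flatten_dropLetters (i : ℕ) (xs : List (List α)) :
    (dropLetters i xs).flatten = xs.flatten.drop i := by
  induction xs generalizing i with
  | nil => simp [dropLetters]
  | cons w ws ih =>
    simp only [dropLetters, List.flatten_append, ih, List.flatten_cons, List.drop_append]
    split_ifs with h
    · simp
    · simp [List.drop_eq_nil_of_le (not_lt.1 h)]

theorem flatten_takeLetters (i : ℕ) (xs : List (List α)) :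
    (takeLetters i xs).flatten = xs.flatten.take i := by
  induction xs generalizing i with
  | nil => simp [takeLetters]
  | cons w ws ih =>
    simp only [takeLetters, List.flatten_append, ih, List.flatten_cons, List.take_append]
    split_ifs with h
    · simp
    · obtain rfl : i = 0 := by omega
      simp

theorem length_dropLetters_le (i : ℕ) (xs : List (List α)) :
    (dropLetters i xs).length ≤ xs.length := by
  induction xs generalizing i with
  | nil => simp [dropLetters]
  | cons w ws ih =>
    have := ih (i - w.length)
    simp only [dropLetters, List.length_append, List.length_cons]
    split_ifs <;> simp <;> omega

theorem length_takeLetters_le (i : ℕ) (xs : List (List α)) :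
    (takeLetters i xs).length ≤ xs.length := by
  induction xs generalizing i with
  | nil => simp [takeLetters]
  | cons w ws ih =>
    have := ih (i - w.length)
    simp only [takeLetters, List.length_append, List.length_cons]
    split_ifs <;> simp <;> omega

theorem dropLetters_eq_nil {i : ℕ} {xs : List (List α)} (h : xs.flatten.length ≤ i) :
    dropLetters i xs = [] := by
  induction xs generalizing i with
  | nil => simp [dropLetters]
  | cons w ws ih =>
    rw [List.flatten_cons, List.length_append] at h
    rw [dropLetters, ih (by omega), if_neg (by omega)]
    rfl

theorem takeLetters_zero (xs : List (List α)) : takeLetters 0 xs = [] := by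
  induction xs with
  | nil => simp [takeLetters]
  | cons w ws ih => simp [takeLetters, ih]

theorem dropLetters_zero {xs : List (List α)} (h : [] ∉ xs) : dropLetters 0 xs = xs := by
  induction xs with
  | nil => simp [dropLetters]
  | cons w ws ih =>
    rw [List.mem_cons, not_or] at h
    rw [dropLetters, Nat.zero_sub, ih h.2, if_pos (List.length_pos_iff.2 (Ne.symm h.1))]
    rfl

theorem takeLetters_of_length_le {i : ℕ} {xs : List (List α)} (h : [] ∉ xs)
    (hi : xs.flatten.length ≤ i) : takeLetters i xs = xs := by
  induction xs generalizing i with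
  | nil => simp [takeLetters]
  | cons w ws ih =>
    rw [List.mem_cons, not_or] at h
    rw [List.flatten_cons, List.length_append] at hi
    have := List.length_pos_iff.2 (Ne.symm h.1)
    rw [takeLetters, ih h.2 (by omega), if_pos (by omega), List.take_of_length_le (by omega)]
    rfl

theorem nil_notMem_dropLetters (i : ℕ) (xs : List (List α)) : [] ∉ dropLetters i xs := by
  induction xs generalizing i with
  | nil => simp [dropLetters]
  | cons w ws ih =>
    rw [dropLetters, List.mem_append, not_or]
    refine ⟨?_, ih _⟩
    split_ifs with h
    · simpa [List.drop_eq_nil_iff] using h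
    · simp

theorem nil_notMem_takeLetters (i : ℕ) {xs : List (List α)} (h : [] ∉ xs) :
    [] ∉ takeLetters i xs := by
  induction xs generalizing i with
  | nil => simp [takeLetters]
  | cons w ws ih =>
    rw [List.mem_cons, not_or] at h
    rw [takeLetters, List.mem_append, not_or]
    refine ⟨?_, ih _ h.2⟩
    split_ifs with hi
    · simpa [List.take_eq_nil_iff] using ⟨by omega, Ne.symm h.1⟩
    · simp

theorem dropLetters_dropLetters (i j : ℕ) (xs : List (List α)) :
    dropLetters i (dropLetters j xs) = dropLetters (j + i) xs := by
  induction xs generalizing i j with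
  | nil => simp [dropLetters]
  | cons w ws ih =>
    rw [dropLetters, dropLetters_append, ih, dropLetters]
    by_cases h : j < w.length
    · rw [if_pos h]
      simp only [dropLetters, List.length_drop, List.drop_drop, List.flatten_singleton]
      congr 1
      · by_cases h' : j + i < w.length
        · rw [if_pos (by omega), if_pos h']; rfl
        · rw [if_neg (by omega), if_neg h']; rfl
      · congr 1; omega
    · rw [if_neg h, if_neg (by omega)]
      simp only [dropLetters, List.flatten_nil, List.length_nil]
      congr 2; omega

theorem takeLetters_takeLetters (i j : ℕ) (xs : List (List α)) :
    takeLetters i (takeLetters j xs) = takeLetters (min i j) xs := by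
  induction xs generalizing i j with
  | nil => simp [takeLetters]
  | cons w ws ih =>
    rw [takeLetters, takeLetters_append, ih, takeLetters]
    by_cases h : 0 < j
    · rw [if_pos h]
      simp only [takeLetters, List.length_take, List.flatten_singleton, List.take_take]
      congr 1
      · by_cases h' : 0 < i
        · rw [if_pos h', if_pos (by omega)]; rfl
        · rw [if_neg h', if_neg (by omega)]; rfl
      · congr 1; omega
    · obtain rfl : j = 0 := by omega
      simp [takeLetters]

theorem dropLetters_takeLetters (i n : ℕ) (xs : List (List α)) :
    dropLetters i (takeLetters (i + n) xs) = takeLetters n (dropLetters i xs) := by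
  induction xs generalizing i n with
  | nil => simp [takeLetters, dropLetters]
  | cons w ws ih =>
    rcases Nat.eq_zero_or_pos n with rfl | hn
    · rw [takeLetters_zero, dropLetters_eq_nil]
      rw [flatten_takeLetters, List.length_take]; omega
    rw [takeLetters, dropLetters_append, dropLetters, takeLetters_append, if_pos (by omega)]
    simp only [dropLetters, List.length_take, List.flatten_singleton, List.append_nil]
    by_cases h : i < w.length
    · rw [if_pos (by omega), if_pos h]
      simp only [takeLetters, if_pos hn, List.flatten_singleton, List.length_drop,
        List.append_nil]
      congr 1
      · rw [List.drop_take]; simp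
      · rw [show i + n - w.length = (i - min (i + n) w.length) + (n - (w.length - i)) by omega, ih]
        congr 2; omega
    · rw [if_neg (by omega), if_neg h]
      simp only [takeLetters, List.flatten_nil, List.length_nil, List.nil_append, Nat.sub_zero]
      rw [show i + n - w.length = (i - min (i + n) w.length) + n by omega, ih]
      congr 2; omega

end

section

variable {α : Type*}

/-! ### Comparing two factorisations of one word -/

/-- The factorisations `xs` and `ys` of the same word coincide, position by position, up to at most
`K` factors at either end. -/
def SameCore (K : ℕ) (xs ys : List (List α)) : Prop :=
  ∃ A B C D M : List (List α), xs = A ++ M ++ B ∧ ys = C ++ M ++ D ∧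
    A.flatten = C.flatten ∧ B.flatten = D.flatten ∧
    A.length ≤ K ∧ B.length ≤ K ∧ C.length ≤ K ∧ D.length ≤ K

theorem SameCore.dropLetters {K : ℕ} {xs ys : List (List α)} (h : SameCore K xs ys) (i : ℕ) :
    SameCore K (dropLetters i xs) (dropLetters i ys) := by
  obtain ⟨A, B, C, D, M, rfl, rfl, hAC, hBD, hA, hB, hC, hD⟩ := h
  refine ⟨WordTheory.dropLetters i A, WordTheory.dropLetters (i - (A ++ M).flatten.length) B,
    WordTheory.dropLetters i C, WordTheory.dropLetters (i - (C ++ M).flatten.length) D,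
    WordTheory.dropLetters (i - A.flatten.length) M, ?_, ?_, ?_, ?_,
    (length_dropLetters_le _ _).trans hA, (length_dropLetters_le _ _).trans hB,
    (length_dropLetters_le _ _).trans hC, (length_dropLetters_le _ _).trans hD⟩
  · rw [dropLetters_append, dropLetters_append]
  · rw [dropLetters_append, dropLetters_append, hAC]
  · rw [flatten_dropLetters, flatten_dropLetters, hAC]
  · rw [flatten_dropLetters, flatten_dropLetters, List.flatten_append, List.flatten_append, hAC,
      hBD]

theorem SameCore.takeLetters {K : ℕ} {xs ys : List (List α)} (h : SameCore K xs ys) (i : ℕ) :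
    SameCore K (takeLetters i xs) (takeLetters i ys) := by
  obtain ⟨A, B, C, D, M, rfl, rfl, hAC, hBD, hA, hB, hC, hD⟩ := h
  refine ⟨WordTheory.takeLetters i A, WordTheory.takeLetters (i - (A ++ M).flatten.length) B,
    WordTheory.takeLetters i C, WordTheory.takeLetters (i - (C ++ M).flatten.length) D,
    WordTheory.takeLetters (i - A.flatten.length) M, ?_, ?_, ?_, ?_,
    (length_takeLetters_le _ _).trans hA, (length_takeLetters_le _ _).trans hB,
    (length_takeLetters_le _ _).trans hC, (length_takeLetters_le _ _).trans hD⟩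
  · rw [takeLetters_append, takeLetters_append]
  · rw [takeLetters_append, takeLetters_append, hAC]
  · rw [flatten_takeLetters, flatten_takeLetters, hAC]
  · rw [flatten_takeLetters, flatten_takeLetters, List.flatten_append, List.flatten_append, hAC,
      hBD]

/-- The property `p` holds for all words with at most `K` exceptions. -/
def AllBut (K : ℕ) (p : List α → Prop) : Prop :=
  ∃ E : Finset (List α), E.card ≤ K ∧ ∀ v ∉ E, p v

theorem AllBut.mono {K K' : ℕ} {p q : List α → Prop} (h : AllBut K p) (hK : K ≤ K')
    (hpq : ∀ v, p v → q v) : AllBut K' q :=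
  let ⟨E, hE, hp⟩ := h
  ⟨E, hE.trans hK, fun v hv => hpq v (hp v hv)⟩

theorem AllBut.of_forall {K : ℕ} {p : List α → Prop} (h : ∀ v, p v) : AllBut K p :=
  ⟨∅, by simp, fun v _ => h v⟩

theorem AllBut.and [DecidableEq α] {K K' : ℕ} {p q : List α → Prop} (hp : AllBut K p)
    (hq : AllBut K' q) : AllBut (K + K') fun v => p v ∧ q v := by
  obtain ⟨E, hE, hp⟩ := hp
  obtain ⟨F, hF, hq⟩ := hq
  refine ⟨E ∪ F, (Finset.card_union_le _ _).trans (by omega), fun v hv => ?_⟩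
  rw [Finset.mem_union, not_or] at hv
  exact ⟨hp v hv.1, hq v hv.2⟩

theorem AllBut.exists_mem {K : ℕ} {p : List α → Prop} (h : AllBut K p) {s : Finset (List α)}
    (hs : K < s.card) : ∃ v ∈ s, p v := by
  obtain ⟨E, hE, hp⟩ := h
  obtain ⟨v, hv, hvE⟩ := Finset.exists_mem_notMem_of_card_lt_card (hE.trans_lt hs)
  exact ⟨v, hv, hp v hvE⟩

variable [DecidableEq α]

theorem replaceFactor_append (xs ys : List (List α)) (v u : List α) :
    replaceFactor (xs ++ ys) v u = replaceFactor xs v u ++ replaceFactor ys v u := by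
  simp [replaceFactor]

theorem replaceFactor_of_notMem {xs : List (List α)} {v : List α} (h : v ∉ xs) (u : List α) :
    replaceFactor xs v u = xs.flatten := by
  induction xs with
  | nil => rfl
  | cons w ws ih =>
    rw [List.mem_cons, not_or] at h
    rw [← List.singleton_append, replaceFactor_append, ih h.2]
    simp [replaceFactor, Ne.symm h.1]

theorem length_replaceFactor (xs : List (List α)) {v u : List α} (h : u.length = v.length) :
    (replaceFactor xs v u).length = xs.flatten.length := by
  induction xs with
  | nil => rfl
  | cons w ws ih =>
    rw [← List.singleton_append, replaceFactor_append, List.length_append, ih,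
      List.flatten_append, List.length_append]
    by_cases hw : w = v
    · simp [replaceFactor, hw, h]
    · simp [replaceFactor, hw]

/-- Replacement of one factor by a word with the same transitions does not change the run of an
automaton. -/
theorem evalFrom_replaceFactor {σ : Type*} (M : DFA α σ) (xs : List (List α)) {v u : List α}
    (h : ∀ q, M.evalFrom q u = M.evalFrom q v) (q : σ) :
    M.evalFrom q (replaceFactor xs v u) = M.evalFrom q xs.flatten := by
  induction xs generalizing q with
  | nil => rfl
  | cons w ws ih =>
    rw [← List.singleton_append, replaceFactor_append, DFA.evalFrom_of_append, ih,
      List.flatten_append, DFA.evalFrom_of_append]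
    by_cases hw : w = v
    · simp [replaceFactor, hw, h]
    · simp [replaceFactor, hw]

/-- Up to at most `K` choices of `v`, replacing `v` has the same effect on both factorisations. -/
def Agree (K : ℕ) (xs ys : List (List α)) : Prop :=
  AllBut K fun v => ∀ u, replaceFactor xs v u = replaceFactor ys v u

theorem Agree.refl (xs : List (List α)) : Agree 0 xs xs := .of_forall fun _ _ => rfl

theorem Agree.symm {K : ℕ} {xs ys : List (List α)} (h : Agree K xs ys) : Agree K ys xs :=
  h.mono le_rfl fun _ hv u => (hv u).symm

theorem Agree.trans {K K' : ℕ} {xs ys zs : List (List α)} (h : Agree K xs ys)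
    (h' : Agree K' ys zs) : Agree (K + K') xs zs :=
  (AllBut.and h h').mono le_rfl fun _ hv u => (hv.1 u).trans (hv.2 u)

theorem Agree.append {K K' : ℕ} {xs ys xs' ys' : List (List α)} (h : Agree K xs ys)
    (h' : Agree K' xs' ys') : Agree (K + K') (xs ++ xs') (ys ++ ys') :=
  (AllBut.and h h').mono le_rfl fun _ hv u => by
    rw [replaceFactor_append, replaceFactor_append, hv.1 u, hv.2 u]

theorem Agree.of_length_le {K K' : ℕ} {xs ys : List (List α)} (h : xs.flatten = ys.flatten)
    (hx : xs.length ≤ K) (hy : ys.length ≤ K') : Agree (K + K') xs ys := by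
  refine ⟨xs.toFinset ∪ ys.toFinset, ?_, fun v hv u => ?_⟩
  · have := Finset.card_union_le xs.toFinset ys.toFinset
    have := xs.toFinset_card_le
    have := ys.toFinset_card_le
    omega
  · rw [Finset.mem_union, not_or, List.mem_toFinset, List.mem_toFinset] at hv
    rw [replaceFactor_of_notMem hv.1, replaceFactor_of_notMem hv.2, h]

theorem SameCore.agree {K : ℕ} {xs ys : List (List α)} (h : SameCore K xs ys) :
    Agree (4 * K) xs ys := by
  obtain ⟨A, B, C, D, M, rfl, rfl, hAC, hBD, hA, hB, hC, hD⟩ := h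
  exact (((Agree.of_length_le hAC hA hC).append (.refl M)).append
    (Agree.of_length_le hBD hB hD)).mono (by omega) fun _ h => h

/-- Cutting a factorisation at a position affects at most one factor, which is split into two. -/
theorem agree_takeLetters_append_dropLetters (i : ℕ) {xs : List (List α)} (h : [] ∉ xs) :
    Agree 3 xs (takeLetters i xs ++ dropLetters i xs) := by
  induction xs generalizing i with
  | nil => exact .of_forall fun _ _ => rfl
  | cons w ws ih =>
    have hws : [] ∉ ws := fun h' => h (List.mem_cons_of_mem _ h')
    rcases Nat.eq_zero_or_pos i with rfl | hi
    · rw [takeLetters_zero, dropLetters_zero h]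
      exact .of_forall fun _ _ => rfl
    rw [takeLetters, dropLetters, if_pos hi]
    by_cases hiw : i < w.length
    · rw [if_pos hiw, Nat.sub_eq_zero_of_le hiw.le, takeLetters_zero, dropLetters_zero hws,
        List.append_nil, ← List.append_assoc, ← List.singleton_append]
      exact (Agree.of_length_le (K := 1) (K' := 2) (by simp) (by simp) (by simp)).append (.refl ws)
    · rw [if_neg hiw, List.take_of_length_le (not_lt.1 hiw), List.nil_append, List.append_assoc]
      exact ((Agree.refl [w]).append (ih (i - w.length) hws)).mono (by omega) fun _ h => h

end

section

variable {α : Type*}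

/-! ### Words with a unique occurrence -/

/-- If `x` does not end in `b`, then `x bᴺ` with `N > |Q|` has only one occurrence
in `Q x bᴺ`. -/
theorem eq_length_of_marker_right {x Q P S : List α} {b : α} {N : ℕ} (hx : x ≠ [])
    (hb : x.getLast hx ≠ b) (hN : Q.length < N)
    (h : Q ++ (x ++ List.replicate N b) = P ++ (x ++ List.replicate N b) ++ S) :
    P.length = Q.length := by
  have hl := congrArg List.length h
  have hx0 := List.length_pos_iff.2 hx
  simp only [List.length_append, List.length_replicate] at hl
  by_contra hne
  -- The last letter of the first `x` would lie inside the second power of `b`.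
  have h1 := congrArg (fun l => l[Q.length + (x.length - 1)]?) h
  rw [List.getElem?_append_right (by omega), List.getElem?_append_left (by omega),
    List.append_assoc, List.getElem?_append_right (by omega),
    List.getElem?_append_left (by simp; omega),
    List.getElem?_append_right (by omega), List.getElem?_replicate, if_pos (by omega),
    show Q.length + (x.length - 1) - Q.length = x.length - 1 by omega,
    ← List.getLast?_eq_getElem?, List.getLast?_eq_getLast_of_ne_nil hx] at h1
  exact hb (Option.some.inj h1)

/-- If `x` does not end in `b`, then `x` has only one occurrence in `x bᴺ`. -/
theorem eq_nil_of_marker_right {x P S : List α} {b : α} {N : ℕ} (hx : x ≠ [])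
    (hb : x.getLast hx ≠ b) (h : x ++ List.replicate N b = P ++ x ++ S) : P = [] := by
  have hl := congrArg List.length h
  have hx0 := List.length_pos_iff.2 hx
  simp only [List.length_append, List.length_replicate] at hl
  by_contra hne
  have hP := List.length_pos_iff.2 hne
  -- The last letter of the second `x` would lie inside the power of `b`.
  have h1 := congrArg (fun l => l[P.length + (x.length - 1)]?) h
  rw [List.getElem?_append_right (by omega), List.getElem?_replicate, if_pos (by omega),
    List.append_assoc, List.getElem?_append_right (by omega),
    List.getElem?_append_left (by omega),
    show P.length + (x.length - 1) - P.length = x.length - 1 by omega,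
    ← List.getLast?_eq_getElem?, List.getLast?_eq_getLast_of_ne_nil hx] at h1
  exact hb (Option.some.inj h1).symm

theorem eq_nil_of_marker_left {x Q P S : List α} {b : α} {N : ℕ} (hx : x ≠ [])
    (hb : x.head hx ≠ b) (hN : Q.length < N)
    (h : List.replicate N b ++ x ++ Q = P ++ (List.replicate N b ++ x) ++ S) : P = [] := by
  have h' := congrArg List.reverse h
  simp only [List.reverse_append, List.reverse_replicate] at h'
  have := eq_length_of_marker_right (x := x.reverse) (Q := Q.reverse) (P := S.reverse)
    (S := P.reverse) (b := b) (N := N) (by simpa using hx) (by simpa using hb) (by simpa using hN)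
    (by simpa using h')
  have hl := congrArg List.length h
  simp at hl this
  exact List.length_eq_zero_iff.1 (by omega)

theorem length_eq_of_marker_left {x P S : List α} {b : α} {N : ℕ} (hx : x ≠ [])
    (hb : x.head hx ≠ b) (h : List.replicate N b ++ x = P ++ x ++ S) : P.length = N := by
  have h' := congrArg List.reverse h
  simp only [List.reverse_append, List.reverse_replicate] at h'
  have := eq_nil_of_marker_right (x := x.reverse) (P := S.reverse)
    (S := P.reverse) (b := b) (N := N) (by simpa using hx) (by simpa using hb) (by simpa using h')
  have hl := congrArg List.length h
  simp at hl this
  simp [this] at hl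
  omega

/-! ### Synchronisation at prescribed occurrences -/

/-- `φ` assigns to each word a factorisation into nonempty words, and these factorisations are
synchronising with the single constant `K` in place of `l` and `r`. -/
structure IsSyncParsing (φ : List α → List (List α)) (K : ℕ) : Prop where
  flatten_eq : ∀ w, (φ w).flatten = w
  nil_notMem : ∀ w, [] ∉ φ w
  sync : ∀ x y : List α, y <:+: x → 2 * K < (φ y).length →
    ∃ A B C D M : List (List α),
      φ x = A ++ M ++ B ∧ φ y = C ++ M ++ D ∧ C.length ≤ K ∧ D.length ≤ K ∧
      C.flatten <:+ (A.drop (A.length - K)).flatten ∧ D.flatten <+: (B.take K).flatten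

theorem IsSynchronising.exists_isSyncParsing {𝔽 : List (List α) → Prop}
    (h : IsSynchronising 𝔽) :
    ∃ φ K, IsSyncParsing φ K ∧ ∀ w ws, IsFactorisation 𝔽 w ws → ws = φ w := by
  choose φ hφ huniq using h.existsUnique
  obtain ⟨l, r, hs⟩ := h.sync
  refine ⟨φ, max l r, ⟨fun w => (hφ w).2.1, fun w => (hφ w).2.2, fun x y hyx hlen => ?_⟩,
    fun w ws hw => huniq w ws hw⟩
  obtain ⟨A, B, C, D, M, hx, hy, -, hC, hD, hCA, hDB⟩ :=
    hs x y _ _ (hφ x) (hφ y) hyx (by omega)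
  refine ⟨A, B, C, D, M, hx, hy, hC.trans (le_max_left _ _), hD.trans (le_max_right _ _),
    hCA.trans ?_, hDB.trans ?_⟩
  · have h1 : A.length - l = (A.length - max l r) + (A.length - l - (A.length - max l r)) := by
      omega
    rw [h1, ← List.drop_drop]
    exact (List.drop_suffix _ _).flatten
  · have h1 := List.take_prefix r (B.take (max l r))
    rw [List.take_take, min_eq_left (le_max_right l r)] at h1
    exact h1.flatten

variable {φ : List α → List (List α)} {K : ℕ}

/-- The factorisation of `y` induced by the factorisation of its occurrence in `P ++ y ++ S`. -/
def inContext (φ : List α → List (List α)) (P y S : List α) : List (List α) :=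
  takeLetters y.length (dropLetters P.length (φ (P ++ y ++ S)))

theorem IsSyncParsing.inContext_nil (hφ : IsSyncParsing φ K) (y : List α) :
    inContext φ [] y [] = φ y := by
  simp only [inContext, List.length_nil, List.nil_append, List.append_nil]
  rw [dropLetters_zero (hφ.nil_notMem y), takeLetters_of_length_le (hφ.nil_notMem y)
    (by rw [hφ.flatten_eq])]

theorem IsSyncParsing.flatten_inContext (hφ : IsSyncParsing φ K) (P y S : List α) :
    (inContext φ P y S).flatten = y := by
  simp [inContext, flatten_takeLetters, flatten_dropLetters, hφ.flatten_eq]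

/-- Restricting an induced factorisation to a factor moves the rest into the context. -/
theorem inContext_restrict (P p y s S : List α) :
    takeLetters y.length (dropLetters p.length (inContext φ P (p ++ y ++ s) S)) =
      inContext φ (P ++ p) y (s ++ S) := by
  have h : (p ++ y ++ s).length = p.length + (y ++ s).length := by simp
  rw [inContext, h, dropLetters_takeLetters, dropLetters_dropLetters, takeLetters_takeLetters,
    inContext]
  simp

/-- The defining property of synchronisation does not say at which occurrence of `y` in `x` the
two factorisations are aligned; if there is only one occurrence, it is this one. -/
theorem IsSyncParsing.sameCore_of_unique (hφ : IsSyncParsing φ K) {P y S : List α}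
    (hy : 2 * K < (φ y).length)
    (huniq : ∀ P' S', P ++ y ++ S = P' ++ y ++ S' → P'.length = P.length) :
    SameCore K (inContext φ [] y []) (inContext φ P y S) := by
  rw [hφ.inContext_nil]
  obtain ⟨A, B, C, D, M, hx, hyM, hC, hD, hCA, hDB⟩ := hφ.sync (P ++ y ++ S) y ⟨P, S, rfl⟩ hy
  have hxf := hφ.flatten_eq (P ++ y ++ S)
  have hyf := hφ.flatten_eq y
  rw [hx] at hxf
  rw [hyM] at hyf
  obtain ⟨P₀, hP₀⟩ := hCA
  obtain ⟨S₀, hS₀⟩ := hDB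
  -- The core `M` of the two factorisations locates one occurrence of `y`, hence the given one.
  have hA : A.flatten = (A.take (A.length - K)).flatten ++ (P₀ ++ C.flatten) := by
    rw [hP₀, ← List.flatten_append, List.take_append_drop]
  have hB : B.flatten = D.flatten ++ (S₀ ++ (B.drop K).flatten) := by
    rw [← List.append_assoc, hS₀, ← List.flatten_append, List.take_append_drop]
  have hP := huniq ((A.take (A.length - K)).flatten ++ P₀) (S₀ ++ (B.drop K).flatten) (by
    rw [← hxf, ← hyf]
    simp only [List.flatten_append, hA, hB, List.append_assoc])
  rw [List.length_append] at hP
  have hAl := congrArg List.length hA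
  have hBl := congrArg List.length hB
  have hyl := congrArg List.length hyf
  simp only [List.length_append, List.flatten_append] at hAl hBl hyl
  have hdropM : dropLetters (P.length - A.flatten.length) M = M := by
    rw [Nat.sub_eq_zero_of_le (by omega)]
    refine dropLetters_zero fun h => hφ.nil_notMem y ?_
    simp [hyM, h]
  have hdropB : dropLetters (P.length - (A ++ M).flatten.length) B = B := by
    rw [Nat.sub_eq_zero_of_le (by rw [List.flatten_append, List.length_append]; omega)]
    refine dropLetters_zero fun h => hφ.nil_notMem (P ++ y ++ S) ?_
    rw [hx]
    exact List.mem_append_right _ h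
  have htakeA : takeLetters y.length (dropLetters P.length A) = dropLetters P.length A := by
    refine takeLetters_of_length_le (nil_notMem_dropLetters _ _) ?_
    rw [flatten_dropLetters, List.length_drop]
    omega
  have htakeM : takeLetters (y.length - (dropLetters P.length A).flatten.length) M = M := by
    refine takeLetters_of_length_le (fun h => hφ.nil_notMem y ?_) ?_
    · simp [hyM, h]
    · rw [flatten_dropLetters, List.length_drop]
      omega
  have hrest : y.length - (dropLetters P.length A ++ M).flatten.length = D.flatten.length := by
    rw [List.flatten_append, List.length_append, flatten_dropLetters, List.length_drop]
    omega
  refine ⟨C, D, dropLetters P.length A, takeLetters D.flatten.length B, M, hyM, ?_, ?_, ?_,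
    hC, hD, ?_, ?_⟩
  · rw [inContext, hx, dropLetters_append, dropLetters_append, hdropM, hdropB, takeLetters_append,
      takeLetters_append, htakeA, htakeM, hrest]
  · rw [flatten_dropLetters, hA, ← List.append_assoc, List.drop_left' (by simpa using hP)]
  · rw [flatten_takeLetters, hB, List.take_left' rfl]
  · rw [← List.take_append_drop (A.length - K) A, dropLetters_append,
      dropLetters_eq_nil (by omega), List.nil_append]
    refine (length_dropLetters_le _ _).trans ?_
    rw [List.length_drop]
    omega
  · rw [← List.take_append_drop K B, takeLetters_append, ← hS₀,
      Nat.sub_eq_zero_of_le (by simp), takeLetters_zero, List.append_nil]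
    refine (length_takeLetters_le _ _).trans ?_
    rw [List.length_take]
    omega

/-- A word has at least as many factors as any word it contains, up to a constant. -/
theorem IsSyncParsing.length_le_of_infix (hφ : IsSyncParsing φ K) {x y : List α} (h : y <:+: x) :
    (φ y).length ≤ (φ x).length + 2 * K := by
  by_cases hy : 2 * K < (φ y).length
  · obtain ⟨A, B, C, D, M, hx, hyM, hC, hD, -, -⟩ := hφ.sync x y h hy
    rw [hx, hyM]
    simp only [List.length_append]
    omega
  · omega

theorem IsSyncParsing.ne_nil_of_length (hφ : IsSyncParsing φ K) {x : List α}
    (h : 0 < (φ x).length) : x ≠ [] := by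
  rintro rfl
  obtain ⟨w, hw⟩ := List.exists_mem_of_length_pos h
  have := List.flatten_eq_nil_iff.1 (hφ.flatten_eq []) w hw
  exact hφ.nil_notMem [] (this ▸ hw)

variable [DecidableEq α]

theorem IsSyncParsing.agree_of_unique (hφ : IsSyncParsing φ K) {P p y s S : List α}
    (hy : 2 * K < (φ (p ++ y ++ s)).length)
    (huniq : ∀ P' S', P ++ (p ++ y ++ s) ++ S = P' ++ (p ++ y ++ s) ++ S' →
      P'.length = P.length) :
    Agree (4 * K) (inContext φ p y s) (inContext φ (P ++ p) y (s ++ S)) := by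
  have h := (((hφ.sameCore_of_unique hy huniq).dropLetters p.length).takeLetters y.length).agree
  rwa [inContext_restrict, inContext_restrict, List.nil_append, List.append_nil] at h

variable [Nontrivial α]

/-- Extending the context to the left does not matter: with a long enough power `bᴺ` of a
letter other than the last letter of `x = p ++ y ++ s`, each of `x ⊑ x bᴺ ⊑ Q x bᴺ ⊒ Q x` is an
inclusion with a unique occurrence. -/
theorem IsSyncParsing.agree_extend_left (hφ : IsSyncParsing φ K) (Q : List α) {p y s : List α}
    (h : 4 * K < (φ (p ++ y ++ s)).length) :
    Agree (12 * K) (inContext φ p y s) (inContext φ (Q ++ p) y s) := by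
  have hx := hφ.ne_nil_of_length (by omega : 0 < (φ (p ++ y ++ s)).length)
  obtain ⟨b, hb⟩ := exists_ne ((p ++ y ++ s).getLast hx)
  set T := List.replicate (Q.length + 1) b with hT
  have h1 := hφ.agree_of_unique (P := []) (p := p) (y := y) (s := s) (S := T) (by omega)
    (fun P' S' he => congrArg List.length
      (eq_nil_of_marker_right (P := P') (S := S') hx hb.symm (by simpa using he)))
  have h2 := hφ.agree_of_unique (P := Q) (p := p) (y := y) (s := s ++ T) (S := [])
    (by
      have := hφ.length_le_of_infix (x := p ++ y ++ (s ++ T)) (y := p ++ y ++ s) ⟨[], T, by simp⟩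
      omega)
    (fun P' S' he => eq_length_of_marker_right hx hb.symm (Nat.lt_succ_self _)
      (by simpa [List.append_assoc] using he))
  have hx' : Q ++ p ++ y ++ s ≠ [] := fun h' => hx (by simp_all)
  have h3 := hφ.agree_of_unique (P := []) (p := Q ++ p) (y := y) (s := s) (S := T)
    (by
      have := hφ.length_le_of_infix (x := Q ++ p ++ y ++ s) (y := p ++ y ++ s) ⟨Q, [], by simp⟩
      omega)
    (fun P' S' he => by
      refine congrArg List.length (eq_nil_of_marker_right (P := P') (S := S') hx' (b := b)
        (N := Q.length + 1) ?_ (by simpa using he))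
      have : (Q ++ p ++ y ++ s).getLast hx' =
          (Q ++ (p ++ y ++ s)).getLast (by simpa using hx') := by
        congr 1; simp
      rw [this, List.getLast_append_of_ne_nil _ hx]
      exact hb.symm)
  simp only [List.nil_append, List.append_nil] at h1 h2 h3
  exact ((h1.trans h2).trans h3.symm).mono (by omega) fun _ h => h

/-- Extending the context to the right does not matter either: the mirror image of the chain in
`IsSyncParsing.agree_extend_left` has a power of a letter other than the first letter of `x` on
the left. -/
theorem IsSyncParsing.agree_extend_right (hφ : IsSyncParsing φ K) (Q : List α) {p y s : List α}
    (h : 4 * K < (φ (p ++ y ++ s)).length) :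
    Agree (12 * K) (inContext φ p y s) (inContext φ p y (s ++ Q)) := by
  have hx := hφ.ne_nil_of_length (by omega : 0 < (φ (p ++ y ++ s)).length)
  obtain ⟨b, hb⟩ := exists_ne ((p ++ y ++ s).head hx)
  set T := List.replicate (Q.length + 1) b with hT
  have h1 := hφ.agree_of_unique (P := T) (p := p) (y := y) (s := s) (S := []) (by omega)
    (fun P' S' he => by
      rw [length_eq_of_marker_left hx hb.symm (by simpa using he), hT, List.length_replicate])
  have h2 := hφ.agree_of_unique (P := []) (p := T ++ p) (y := y) (s := s) (S := Q)
    (by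
      have := hφ.length_le_of_infix (x := T ++ p ++ y ++ s) (y := p ++ y ++ s) ⟨T, [], by simp⟩
      omega)
    (fun P' S' he => congrArg List.length
      (eq_nil_of_marker_left (P := P') (S := S') hx hb.symm (Nat.lt_succ_self Q.length)
        (by simpa [List.append_assoc] using he)))
  have hx' : p ++ y ++ (s ++ Q) ≠ [] := fun h' => hx (by simp_all)
  have h3 := hφ.agree_of_unique (P := T) (p := p) (y := y) (s := s ++ Q) (S := [])
    (by
      have := hφ.length_le_of_infix (x := p ++ y ++ (s ++ Q)) (y := p ++ y ++ s) ⟨[], Q, by simp⟩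
      omega)
    (fun P' S' he => by
      rw [hT, List.length_replicate]
      refine length_eq_of_marker_left (P := P') (S := S') hx' (b := b) ?_ (by simpa using he)
      have : (p ++ y ++ (s ++ Q)).head hx' = ((p ++ y ++ s) ++ Q).head (by simpa using hx') := by
        congr 1; simp
      rw [this, List.head_append_of_ne_nil hx]
      exact hb.symm)
  simp only [List.nil_append, List.append_nil] at h1 h2 h3
  exact ((h1.trans h2).trans h3.symm).mono (by omega) fun _ h => h

end

section

variable {α : Type*}

/-! ### Terms, pairs of different words, and short representatives -/

theorem ExtTerm.eval_cons (h : ℕ → List α) (t : ℕ ⊕ α) (s : ExtTerm α) :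
    ExtTerm.eval h (t :: s) = Sum.elim h (fun a => [a]) t ++ ExtTerm.eval h s := rfl

/-- Two different words either are a word and a proper prefix of it, or have different letters
after a common prefix. -/
theorem eq_append_of_ne {x y : List α} (h : x ≠ y) :
    (∃ a z, x = y ++ ([a] ++ z)) ∨ (∃ a z, y = x ++ ([a] ++ z)) ∨
      ∃ p a b z z', a ≠ b ∧ x = p ++ ([a] ++ z) ∧ y = p ++ ([b] ++ z') := by
  induction x generalizing y with
  | nil =>
    cases y with
    | nil => exact absurd rfl h
    | cons b y => exact .inr (.inl ⟨b, y, rfl⟩)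
  | cons a x ih =>
    cases y with
    | nil => exact .inl ⟨a, x, rfl⟩
    | cons b y =>
      by_cases hab : a = b
      · subst hab
        rcases ih (fun h' => h (h' ▸ rfl)) with ⟨c, z, rfl⟩ | ⟨c, z, rfl⟩ |
          ⟨p, c, d, z, z', hcd, rfl, rfl⟩
        · exact .inl ⟨c, z, rfl⟩
        · exact .inr (.inl ⟨c, z, rfl⟩)
        · exact .inr (.inr ⟨a :: p, c, d, z, z', hcd, rfl, rfl⟩)
      · exact .inr (.inr ⟨[], a, b, x, y, hab, rfl, rfl⟩)

/-- Every word is equivalent, with respect to an invariant `τ` with finitely many values, to a word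
of bounded length. -/
theorem exists_length_le_of_finite {T : Type*} [Finite T] (τ : List α → T) :
    ∃ e : ℕ, ∀ v, ∃ u : List α, u.length ≤ e ∧ τ u = τ v := by
  have := Fintype.ofFinite T
  classical
  refine ⟨Finset.univ.sup fun t => if h : ∃ u, τ u = t then h.choose.length else 0, fun v => ?_⟩
  have hv : ∃ u, τ u = τ v := ⟨v, rfl⟩
  refine ⟨hv.choose, ?_, hv.choose_spec⟩
  have := Finset.le_sup (f := fun t => if h : ∃ u, τ u = t then h.choose.length else 0)
    (Finset.mem_univ (τ v))
  simpa only [dif_pos hv] using this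

variable [DecidableEq α] {φ : List α → List (List α)} {K : ℕ}

/-! ### A replacement that is almost a morphism -/

/-- Replace `v` by `u` in the factorisation of `y` that is induced by the factorisation of
`W ++ y ++ W`. The padding `W` is a word with many factors: without it, the factorisation of a word
with few factors would be unrelated to the factorisations of the words that contain it. -/
def subst (φ : List α → List (List α)) (W v u y : List α) : List α :=
  replaceFactor (inContext φ W y W) v u

theorem IsSyncParsing.agree_inContext_append [Nontrivial α] (hφ : IsSyncParsing φ K)
    {W : List α} (hW : 6 * K < (φ W).length) (y z : List α) :
    Agree (48 * K + 3) (inContext φ W (y ++ z) W) (inContext φ W y W ++ inContext φ W z W) := by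
  have hmany (x : List α) (hx : W <:+: x) : 4 * K < (φ x).length := by
    have := hφ.length_le_of_infix hx
    omega
  have hnil : [] ∉ inContext φ W (y ++ z) W :=
    nil_notMem_takeLetters _ (nil_notMem_dropLetters _ _)
  have hcut := agree_takeLetters_append_dropLetters y.length hnil
  have hleft : takeLetters y.length (inContext φ W (y ++ z) W) = inContext φ W y (z ++ W) := by
    have := inContext_restrict (φ := φ) W [] y z W
    rw [List.nil_append, List.length_nil, dropLetters_zero hnil, List.append_nil] at this
    exact this
  have hright : dropLetters y.length (inContext φ W (y ++ z) W) = inContext φ (W ++ y) z W := by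
    have := inContext_restrict (φ := φ) W y z [] W
    rw [List.append_nil, List.nil_append] at this
    rw [← this, inContext, takeLetters_of_length_le (i := z.length)
      (nil_notMem_dropLetters _ _)]
    rw [flatten_dropLetters, flatten_takeLetters, List.length_drop, List.length_take,
      List.length_append]
    omega
  rw [hleft, hright] at hcut
  -- The contexts of `y` on both sides of the claim extend `(W, [])`, those of `z` extend `([], W)`.
  have hy : Agree (24 * K) (inContext φ W y (z ++ W)) (inContext φ W y W) := by
    have h (Q : List α) := hφ.agree_extend_right Q (p := W) (y := y) (s := [])
      (hmany _ ⟨[], y, by simp⟩)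
    simp only [List.nil_append] at h
    exact ((h (z ++ W)).symm.trans (h W)).mono (by omega) fun _ h => h
  have hz : Agree (24 * K) (inContext φ (W ++ y) z W) (inContext φ W z W) := by
    have h (Q : List α) := hφ.agree_extend_left Q (p := []) (y := z) (s := W)
      (hmany _ ⟨z, [], by simp⟩)
    simp only [List.append_nil] at h
    exact ((h (W ++ y)).symm.trans (h W)).mono (by omega) fun _ h => h
  exact (hcut.trans (hy.append hz)).mono (by omega) fun _ h => h

theorem IsSyncParsing.subst_append [Nontrivial α] (hφ : IsSyncParsing φ K)
    {W : List α} (hW : 6 * K < (φ W).length) (y z : List α) :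
    AllBut (48 * K + 3) fun v => ∀ u,
      subst φ W v u (y ++ z) = subst φ W v u y ++ subst φ W v u z :=
  (hφ.agree_inContext_append hW y z).mono le_rfl fun _ h u => by
    simp only [subst, ← replaceFactor_append, h u]

/-- On a word with many factors, the padding is immaterial. -/
theorem IsSyncParsing.subst_eq_replaceFactor [Nontrivial α] (hφ : IsSyncParsing φ K)
    {W : List α} (hW : 6 * K < (φ W).length) {w : List α} (hw : 4 * K < (φ w).length) :
    AllBut (24 * K) fun v => ∀ u, subst φ W v u w = replaceFactor (φ w) v u := by
  have h1 := hφ.agree_extend_left W (p := []) (y := w) (s := []) (by simpa using hw)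
  have h2 := hφ.agree_extend_right W (p := W) (y := w) (s := []) (by
    have := hφ.length_le_of_infix (x := W ++ w ++ []) (y := W) ⟨[], w, by simp⟩
    omega)
  rw [List.append_nil, hφ.inContext_nil] at h1
  rw [List.nil_append] at h2
  exact (h1.trans h2).symm.mono (by omega) fun _ h => h

theorem subst_nil (W v u : List α) : subst φ W v u [] = [] := by
  rw [subst, inContext, List.length_nil, takeLetters_zero]
  rfl

theorem IsSyncParsing.subst_singleton (hφ : IsSyncParsing φ K) (W u : List α) {v : List α} {a : α}
    (h : v ≠ [a]) : subst φ W v u [a] = [a] := by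
  have hf := hφ.flatten_inContext W [a] W
  have hn : [] ∉ inContext φ W [a] W :=
    nil_notMem_takeLetters _ (nil_notMem_dropLetters _ _)
  rw [subst, replaceFactor_of_notMem _ u, hf]
  intro hv
  have hsub := (List.sublist_flatten_of_mem hv)
  rw [hf] at hsub
  rcases List.sublist_singleton.1 hsub with h' | h'
  · exact hn (h' ▸ hv)
  · exact h h'

theorem IsSyncParsing.length_subst (hφ : IsSyncParsing φ K) (W : List α) {v u : List α}
    (h : u.length = v.length) (y : List α) : (subst φ W v u y).length = y.length := by
  rw [subst, length_replaceFactor _ h, hφ.flatten_inContext]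

theorem IsSyncParsing.evalFrom_subst {σ : Type*} (hφ : IsSyncParsing φ K) (M : DFA α σ)
    (W : List α) {v u : List α} (h : ∀ q, M.evalFrom q u = M.evalFrom q v) (q : σ) (y : List α) :
    M.evalFrom q (subst φ W v u y) = M.evalFrom q y := by
  rw [subst, evalFrom_replaceFactor M _ h, hφ.flatten_inContext]

/-! ### Truth of formulas under the replacement -/

theorem IsSyncParsing.exists_eval_subst [Nontrivial α] (hφ : IsSyncParsing φ K) {W : List α}
    (hW : 6 * K < (φ W).length) (s : ExtTerm α) :
    ∃ N, ∀ h : ℕ → List α, AllBut N fun v => ∀ u,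
      ExtTerm.eval (fun i => subst φ W v u (h i)) s = subst φ W v u (ExtTerm.eval h s) := by
  induction s with
  | nil => exact ⟨0, fun h => .of_forall fun v u => (subst_nil W v u).symm⟩
  | cons t s ih =>
    obtain ⟨N, hN⟩ := ih
    have ht (h : ℕ → List α) : AllBut 1 fun v => ∀ u,
        Sum.elim (fun i => subst φ W v u (h i)) (fun a => [a]) t =
          subst φ W v u (Sum.elim h (fun a => [a]) t) := by
      cases t with
      | inl i => exact .of_forall fun _ _ => rfl
      | inr a => exact ⟨{[a]}, by simp, fun v hv u =>
          (hφ.subst_singleton W u (by simpa using hv)).symm⟩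
    refine ⟨N + 1 + (48 * K + 3), fun h => (((hN h).and (ht h)).and (hφ.subst_append hW
      (Sum.elim h (fun a => [a]) t) (ExtTerm.eval h s))).mono le_rfl fun v hv u => ?_⟩
    rw [ExtTerm.eval_cons, ExtTerm.eval_cons, hv.2 u, hv.1.1 u, hv.1.2 u]

/-- Different words stay different: the difference is witnessed by the factorisations of
`eq_append_of_ne`, and these are preserved. -/
theorem IsSyncParsing.exists_subst_ne [Nontrivial α] (hφ : IsSyncParsing φ K) {W : List α}
    (hW : 6 * K < (φ W).length) :
    ∃ N, ∀ x y : List α, x ≠ y → AllBut N fun v => ∀ u, subst φ W v u x ≠ subst φ W v u y := by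
  have key (p z : List α) (a : α) : AllBut (96 * K + 7) fun v => ∀ u,
      subst φ W v u (p ++ ([a] ++ z)) = subst φ W v u p ++ a :: subst φ W v u z := by
    have ha : AllBut 1 fun v => ∀ u, subst φ W v u [a] = [a] :=
      ⟨{[a]}, by simp, fun v hv u => hφ.subst_singleton W u (by simpa using hv)⟩
    refine ((ha.and (hφ.subst_append hW p ([a] ++ z))).and
      (hφ.subst_append hW [a] z)).mono (by omega) fun v hv u => ?_
    rw [hv.1.2, hv.2, hv.1.1]
    rfl
  refine ⟨2 * (96 * K + 7), fun x y hxy => ?_⟩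
  rcases eq_append_of_ne hxy with ⟨a, z, rfl⟩ | ⟨a, z, rfl⟩ | ⟨p, a, b, z, z', hab, rfl, rfl⟩
  · refine (key y z a).mono (by omega) fun v hv u => ?_
    rw [hv u]
    simp
  · refine (key x z a).mono (by omega) fun v hv u => ?_
    rw [hv u]
    simp
  · refine ((key p z a).and (key p z' b)).mono (by omega) fun v hv u => ?_
    rw [hv.1 u, hv.2 u]
    simp [hab]

/-- For all but a bounded number of words `v`, replacing `v` by a word `u` with `R v u` in all
values of a substitution does not change the truth value of `f`. -/
def Invariant (φ : List α → List (List α)) (W : List α) (R : List α → List α → Prop)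
    (f : Formula α) : Prop :=
  ∃ N, ∀ h : ℕ → List α, AllBut N fun v => ∀ u, R v u →
    (f.Holds (fun i => subst φ W v u (h i)) ↔ f.Holds h)

theorem Invariant.weaken {W : List α} {R R' : List α → List α → Prop} {f : Formula α}
    (hf : Invariant φ W R f) (hR : ∀ v u, R' v u → R v u) : Invariant φ W R' f :=
  let ⟨N, hN⟩ := hf
  ⟨N, fun h => (hN h).mono le_rfl fun v hv u hu => hv u (hR v u hu)⟩

theorem Invariant.map₂ {W : List α} {R : List α → List α → Prop} {f g k : Formula α}
    (hf : Invariant φ W R f) (hg : Invariant φ W R g)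
    (hk : ∀ h h' : ℕ → List α, (f.Holds h ↔ f.Holds h') → (g.Holds h ↔ g.Holds h') →
      (k.Holds h ↔ k.Holds h')) : Invariant φ W R k :=
  let ⟨N, hN⟩ := hf
  let ⟨N', hN'⟩ := hg
  ⟨N + N', fun h => ((hN h).and (hN' h)).mono le_rfl fun _ hv u hu =>
    hk _ _ (hv.1 u hu) (hv.2 u hu)⟩

section Connectives

variable {W : List α} {R : List α → List α → Prop} {f g : Formula α}

theorem Invariant.not (hf : Invariant φ W R f) : Invariant φ W R (.not f) :=
  hf.map₂ hf fun _ _ h _ => by simp only [Formula.Holds, h]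

theorem Invariant.and (hf : Invariant φ W R f) (hg : Invariant φ W R g) :
    Invariant φ W R (.and f g) :=
  hf.map₂ hg fun _ _ h h' => by simp only [Formula.Holds, h, h']

theorem Invariant.or (hf : Invariant φ W R f) (hg : Invariant φ W R g) :
    Invariant φ W R (.or f g) :=
  hf.map₂ hg fun _ _ h h' => by simp only [Formula.Holds, h, h']

theorem Invariant.imp (hf : Invariant φ W R f) (hg : Invariant φ W R g) :
    Invariant φ W R (.imp f g) :=
  hf.map₂ hg fun _ _ h h' => by simp only [Formula.Holds, h, h']

theorem Invariant.iff (hf : Invariant φ W R f) (hg : Invariant φ W R g) :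
    Invariant φ W R (.iff f g) :=
  hf.map₂ hg fun _ _ h h' => by simp only [Formula.Holds, h, h']

end Connectives

theorem IsSyncParsing.invariant_wordEq [Nontrivial α] (hφ : IsSyncParsing φ K) {W : List α}
    (hW : 6 * K < (φ W).length) (R : List α → List α → Prop) (s t : ExtTerm α) :
    Invariant φ W R (.wordEq s t) := by
  obtain ⟨N₁, h₁⟩ := hφ.exists_eval_subst hW s
  obtain ⟨N₂, h₂⟩ := hφ.exists_eval_subst hW t
  obtain ⟨N₃, h₃⟩ := hφ.exists_subst_ne hW
  refine ⟨N₁ + N₂ + N₃, fun h => ?_⟩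
  have hne : AllBut N₃ fun v => ∀ u, ExtTerm.eval h s ≠ ExtTerm.eval h t →
      subst φ W v u (ExtTerm.eval h s) ≠ subst φ W v u (ExtTerm.eval h t) := by
    by_cases he : ExtTerm.eval h s = ExtTerm.eval h t
    · exact .of_forall fun v u h' => absurd he h'
    · exact (h₃ _ _ he).mono le_rfl fun v hv u _ => hv u
  refine (((h₁ h).and (h₂ h)).and hne).mono le_rfl fun v hv u _ => ?_
  simp only [Formula.Holds]
  rw [hv.1.1 u, hv.1.2 u]
  exact ⟨fun he => by_contra fun h' => hv.2 u h' he, fun he => by rw [he]⟩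

theorem IsSyncParsing.invariant_lenEq (hφ : IsSyncParsing φ K) (W : List α) (s t : LenTerm α) :
    Invariant φ W (fun v u => u.length = v.length) (.lenEq s t) := by
  refine ⟨0, fun h => .of_forall fun v u hvu => ?_⟩
  have hb (b : BasicTerm α) :
      (b.eval fun i => subst φ W v u (h i)).length = (b.eval h).length := by
    cases b with
    | var i => exact hφ.length_subst W hvu _
    | word w => rfl
  simp only [Formula.Holds, LenTerm.eval, hb]

theorem IsSyncParsing.invariant_mem [Nontrivial α] (hφ : IsSyncParsing φ K) {W : List α}
    (hW : 6 * K < (φ W).length) {σ : Type*} (M : DFA α σ) (s : ExtTerm α) :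
    Invariant φ W (fun v u => ∀ q, M.evalFrom q u = M.evalFrom q v) (.mem s M.accepts) := by
  obtain ⟨N, hN⟩ := hφ.exists_eval_subst hW s
  refine ⟨N, fun h => (hN h).mono le_rfl fun v hv u hvu => ?_⟩
  simp only [Formula.Holds, DFA.mem_accepts, DFA.eval]
  rw [hv u, hφ.evalFrom_subst M W hvu]

theorem IsSyncParsing.invariant_of_isWELEN [Nontrivial α] (hφ : IsSyncParsing φ K) {W : List α}
    (hW : 6 * K < (φ W).length) {f : Formula α} (hf : f.IsWELEN) :
    Invariant φ W (fun v u => u.length = v.length) f := by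
  induction f with
  | mem s L => exact hf.elim
  | lenEq s t => exact hφ.invariant_lenEq W s t
  | wordEq s t => exact hφ.invariant_wordEq hW _ s t
  | not f ih => exact (ih hf).not
  | and f g ihf ihg => exact (ihf hf.1).and (ihg hf.2)
  | or f g ihf ihg => exact (ihf hf.1).or (ihg hf.2)
  | imp f g ihf ihg => exact (ihf hf.1).imp (ihg hf.2)
  | iff f g ihf ihg => exact (ihf hf.1).iff (ihg hf.2)

/-- The finite type `T` plays the role of a finite monoid that recognises all languages in `f`. -/
theorem IsSyncParsing.exists_invariant_of_isWEREG [Nontrivial α] (hφ : IsSyncParsing φ K)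
    {W : List α} (hW : 6 * K < (φ W).length) {f : Formula α} (hf : f.IsWEREG) :
    ∃ (T : Type) (_ : Finite T) (τ : List α → T), Invariant φ W (fun v u => τ u = τ v) f := by
  have map₂ {f g k : Formula α}
      (hf : ∃ (T : Type) (_ : Finite T) (τ : List α → T), Invariant φ W (fun v u => τ u = τ v) f)
      (hg : ∃ (T : Type) (_ : Finite T) (τ : List α → T), Invariant φ W (fun v u => τ u = τ v) g)
      (hk : ∀ R, Invariant φ W R f → Invariant φ W R g → Invariant φ W R k) :
      ∃ (T : Type) (_ : Finite T) (τ : List α → T), Invariant φ W (fun v u => τ u = τ v) k := by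
    obtain ⟨T, _, τ, h⟩ := hf
    obtain ⟨T', _, τ', h'⟩ := hg
    exact ⟨T × T', inferInstance, fun w => (τ w, τ' w), hk _
      (h.weaken fun v u e => congrArg Prod.fst e) (h'.weaken fun v u e => congrArg Prod.snd e)⟩
  induction f with
  | mem s L =>
    obtain ⟨σ, _, M, rfl⟩ := hf
    exact ⟨σ → σ, inferInstance, fun w q => M.evalFrom q w,
      (hφ.invariant_mem hW M s).weaken fun v u e q => congrFun e q⟩
  | lenEq s t => exact hf.elim
  | wordEq s t => exact ⟨Unit, inferInstance, fun _ => (), hφ.invariant_wordEq hW _ s t⟩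
  | not f ih => exact map₂ (ih hf) (ih hf) fun _ h _ => h.not
  | and f g ihf ihg => exact map₂ (ihf hf.1) (ihg hf.2) fun _ => .and
  | or f g ihf ihg => exact map₂ (ihf hf.1) (ihg hf.2) fun _ => .or
  | imp f g ihf ihg => exact map₂ (ihf hf.1) (ihg hf.2) fun _ => .imp
  | iff f g ihf ihg => exact map₂ (ihf hf.1) (ihg hf.2) fun _ => .iff

/-- If the words have an unbounded number of factors, then in each word of the expressed language
all but a bounded number of factors can be replaced. -/
theorem IsSyncParsing.exists_replaceFactor_mem [Nontrivial α] (hφ : IsSyncParsing φ K)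
    {W : List α} (hW : 6 * K < (φ W).length) {R : List α → List α → Prop} {f : Formula α}
    (hf : Invariant φ W R f) (x : ℕ) :
    ∃ d, ∀ w ∈ f.expressed x, ∀ s : Finset (List α), s ⊆ (φ w).toFinset → d < s.card →
      ∃ v ∈ s, ∀ u, R v u → replaceFactor (φ w) v u ∈ f.expressed x := by
  obtain ⟨N, hN⟩ := hf
  refine ⟨N + 24 * K, ?_⟩
  rintro w ⟨h, hh, rfl⟩ s hs hd
  have := (Finset.card_le_card hs).trans (List.toFinset_card_le _)
  obtain ⟨v, hv, hv₁, hv₂⟩ :=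
    ((hN h).and (hφ.subst_eq_replaceFactor hW (w := h x) (by omega))).exists_mem hd
  exact ⟨v, hv, fun u hu => ⟨_, (hv₁ u hu).2 hh, hv₂ u⟩⟩

theorem IsSynchronising.welen_of_nontrivial [Nontrivial α] {𝔽 : List (List α) → Prop}
    (h𝔽 : IsSynchronising 𝔽) {f : Formula α} (hf : f.IsWELEN) (x : ℕ) :
    ∃ d : ℕ, ∀ w ∈ f.expressed x, ∀ ws, IsFactorisation 𝔽 w ws → d < ws.toFinset.card →
      ∃ v ∈ ws, ∀ u : List α, u.length = v.length → replaceFactor ws v u ∈ f.expressed x := by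
  obtain ⟨φ, K, hφ, huniq⟩ := h𝔽.exists_isSyncParsing
  by_cases hW : ∃ W, 6 * K < (φ W).length
  · obtain ⟨W, hW⟩ := hW
    obtain ⟨d, hd⟩ := hφ.exists_replaceFactor_mem hW (hφ.invariant_of_isWELEN hW hf) x
    refine ⟨d, fun w hw ws hws hcard => ?_⟩
    obtain rfl := huniq w ws hws
    obtain ⟨v, hv, h⟩ := hd w hw _ subset_rfl hcard
    exact ⟨v, List.mem_toFinset.1 hv, h⟩
  · push Not at hW
    refine ⟨6 * K, fun w hw ws hws hcard => ?_⟩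
    obtain rfl := huniq w ws hws
    exact absurd hcard (not_lt.2 ((List.toFinset_card_le _).trans (hW w)))

theorem IsSynchronising.wereg_of_nontrivial [Nontrivial α] {𝔽 : List (List α) → Prop}
    (h𝔽 : IsSynchronising 𝔽) {f : Formula α} (hf : f.IsWEREG) (x : ℕ) :
    ∃ d e : ℕ, ∀ w ∈ f.expressed x, ∀ ws, IsFactorisation 𝔽 w ws →
      d < (ws.toFinset.filter (fun v => e < v.length)).card →
      ∃ v ∈ ws, e < v.length ∧ ∃ u : List α, u.length < v.length ∧
        replaceFactor ws v u ∈ f.expressed x := by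
  obtain ⟨φ, K, hφ, huniq⟩ := h𝔽.exists_isSyncParsing
  by_cases hW : ∃ W, 6 * K < (φ W).length
  · obtain ⟨W, hW⟩ := hW
    obtain ⟨T, _, τ, hτ⟩ := hφ.exists_invariant_of_isWEREG hW hf
    obtain ⟨d, hd⟩ := hφ.exists_replaceFactor_mem hW hτ x
    obtain ⟨e, he⟩ := exists_length_le_of_finite τ
    refine ⟨d, e, fun w hw ws hws hcard => ?_⟩
    obtain rfl := huniq w ws hws
    obtain ⟨v, hv, h⟩ := hd w hw _ (Finset.filter_subset _ _) hcard
    rw [Finset.mem_filter, List.mem_toFinset] at hv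
    obtain ⟨u, hu, huv⟩ := he v
    exact ⟨v, hv.1, hv.2, u, hu.trans_lt hv.2, h u huv⟩
  · push Not at hW
    refine ⟨6 * K, 0, fun w hw ws hws hcard => ?_⟩
    obtain rfl := huniq w ws hws
    exact absurd hcard (not_lt.2 ((Finset.card_filter_le _ _).trans
      ((List.toFinset_card_le _).trans (hW w))))

end

section

variable {α : Type*}

/-! ### Alphabets with one letter -/

/-- The truth of a formula depends on finitely many variables only. -/
theorem Formula.exists_holds_congr {f : Formula α} (hf : f.IsWEREG) :
    ∃ N, ∀ h h' : ℕ → List α, (∀ i < N, h i = h' i) → (f.Holds h ↔ f.Holds h') := by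
  have ext (s : ExtTerm α) : ∃ N, ∀ h h' : ℕ → List α, (∀ i < N, h i = h' i) →
      ExtTerm.eval h s = ExtTerm.eval h' s := by
    induction s with
    | nil => exact ⟨0, fun _ _ _ => rfl⟩
    | cons t s ih =>
      obtain ⟨N, hN⟩ := ih
      cases t with
      | inl i =>
        refine ⟨max N (i + 1), fun h h' hh => ?_⟩
        rw [ExtTerm.eval_cons, ExtTerm.eval_cons, hN h h' fun j hj => hh j (by omega)]
        exact congrArg (· ++ _) (hh i (by omega))
      | inr a =>
        refine ⟨N, fun h h' hh => ?_⟩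
        rw [ExtTerm.eval_cons, ExtTerm.eval_cons, hN h h' hh]
        rfl
  simp only [← eq_iff_iff]
  induction f with
  | mem s L =>
    obtain ⟨N, hN⟩ := ext s
    exact ⟨N, fun h h' hh => by simp only [Formula.Holds, hN h h' hh]⟩
  | lenEq s t => exact hf.elim
  | wordEq s t =>
    obtain ⟨N, hN⟩ := ext s
    obtain ⟨N', hN'⟩ := ext t
    exact ⟨max N N', fun h h' hh => by
      simp only [Formula.Holds, hN h h' fun i hi => hh i (by omega),
        hN' h h' fun i hi => hh i (by omega)]⟩
  | not f ih =>
    obtain ⟨N, hN⟩ := ih hf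
    exact ⟨N, fun h h' hh => by simp only [Formula.Holds, hN h h' hh]⟩
  | and f g ihf ihg | or f g ihf ihg | imp f g ihf ihg | iff f g ihf ihg =>
    obtain ⟨N, hN⟩ := ihf hf.1
    obtain ⟨N', hN'⟩ := ihg hf.2
    exact ⟨max N N', fun h h' hh => by
      simp only [Formula.Holds, hN h h' fun i hi => hh i (by omega),
        hN' h h' fun i hi => hh i (by omega)]⟩

/-- The lengths of the powers of `a` in a regular language form an ultimately periodic set, also
after a shift by `c`. -/
theorem isSemilinearSet_replicate_mem {L : Language α} (hL : L.IsRegular) (a : α) (c : ℕ) :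
    IsSemilinearSet {m : ℕ | List.replicate (m + c) a ∈ L} := by
  obtain ⟨σ, _, M, rfl⟩ := hL
  let state (m : ℕ) : σ := M.eval (List.replicate m a)
  have hadd (m n : ℕ) : state (m + n) = M.evalFrom (state m) (List.replicate n a) := by
    simp only [state, List.replicate_add, DFA.eval, DFA.evalFrom_of_append]
  obtain ⟨i, j, hij, he⟩ := Finite.exists_ne_map_eq_of_infinite state
  wlog hlt : i < j generalizing i j
  · exact this j i hij.symm he.symm (by omega)
  rw [Nat.isSemilinearSet_iff_ultimately_periodic]
  refine ⟨i, j - i, by omega, fun m hm => ?_⟩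
  have h : state (m + c) = state (m + (j - i) + c) := by
    rw [show m + c = i + (m - i + c) by omega, show m + (j - i) + c = j + (m - i + c) by omega,
      hadd, hadd, he]
  change state (m + c) ∈ M.accept ↔ state (m + (j - i) + c) ∈ M.accept
  rw [h]

/-- The substitution of powers of `a` for the first `N` variables whose exponents are given
by `n`. -/
def powerSubst (a : α) {N : ℕ} (n : Fin N → ℕ) (i : ℕ) : List α :=
  List.replicate (if h : i < N then n ⟨i, h⟩ else 0) a

theorem exists_length_eval_powerSubst (a : α) (N : ℕ) (s : ExtTerm α) :
    ∃ (g : (Fin N → ℕ) →+ ℕ) (c : ℕ), ∀ n, (ExtTerm.eval (powerSubst a n) s).length = g n + c := by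
  induction s with
  | nil => exact ⟨0, 0, fun _ => rfl⟩
  | cons t s ih =>
    obtain ⟨g, c, hg⟩ := ih
    cases t with
    | inl i =>
      by_cases hi : i < N
      · refine ⟨Pi.evalAddMonoidHom _ ⟨i, hi⟩ + g, c, fun n => ?_⟩
        rw [ExtTerm.eval_cons, List.length_append, hg]
        simp [powerSubst, hi, add_assoc]
      · refine ⟨g, c, fun n => ?_⟩
        rw [ExtTerm.eval_cons, List.length_append, hg]
        simp [powerSubst, hi]
    | inr b =>
      refine ⟨g, c + 1, fun n => ?_⟩
      rw [ExtTerm.eval_cons, List.length_append, hg]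
      simp only [Sum.elim_inr, List.length_singleton]
      omega

theorem eq_replicate_of_subsingleton [Subsingleton α] (a : α) (w : List α) :
    w = List.replicate w.length a :=
  List.eq_replicate_iff.2 ⟨rfl, fun _ _ => Subsingleton.elim _ _⟩

theorem Formula.isSemilinearSet_holds [Subsingleton α] (a : α) (N : ℕ) {f : Formula α}
    (hf : f.IsWEREG) : IsSemilinearSet {n : Fin N → ℕ | f.Holds (powerSubst a n)} := by
  induction f with
  | mem s L =>
    obtain ⟨g, c, hg⟩ := exists_length_eval_powerSubst a N s
    convert (isSemilinearSet_replicate_mem hf a c).preimage g using 1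
    ext n
    change ExtTerm.eval (powerSubst a n) s ∈ L ↔ List.replicate (g n + c) a ∈ L
    rw [← hg, ← eq_replicate_of_subsingleton]
  | lenEq s t => exact hf.elim
  | wordEq s t =>
    obtain ⟨g, c, hg⟩ := exists_length_eval_powerSubst a N s
    obtain ⟨g', c', hg'⟩ := exists_length_eval_powerSubst a N t
    convert isSemilinearSet_setOfPred_eq c c' g g' using 1
    ext n
    change ExtTerm.eval (powerSubst a n) s = ExtTerm.eval (powerSubst a n) t ↔
      c + g n = c' + g' n
    rw [add_comm c, add_comm c', ← hg, ← hg']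
    refine ⟨congrArg _, fun h => ?_⟩
    rw [eq_replicate_of_subsingleton a (ExtTerm.eval (powerSubst a n) s), h,
      ← eq_replicate_of_subsingleton]
  | not f ih => exact (ih hf).compl
  | and f g ihf ihg => exact (ihf hf.1).inter (ihg hf.2)
  | or f g ihf ihg => exact (ihf hf.1).union (ihg hf.2)
  | imp f g ihf ihg =>
    convert (ihf hf.1).compl.union (ihg hf.2) using 1
    ext n
    exact imp_iff_not_or
  | iff f g ihf ihg =>
    convert ((ihf hf.1).inter (ihg hf.2)).union ((ihf hf.1).compl.inter (ihg hf.2).compl) using 1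
    ext n
    exact iff_iff_and_or_not_and_not

/-- Over one letter, the language expressed by a variable is ultimately periodic. -/
theorem Formula.exists_period [Subsingleton α] (a : α) {f : Formula α} (hf : f.IsWEREG) (x : ℕ) :
    ∃ k, ∃ p > 0, ∀ m ≥ k, List.replicate m a ∈ f.expressed x ↔
      List.replicate (m + p) a ∈ f.expressed x := by
  obtain ⟨N₀, hN₀⟩ := Formula.exists_holds_congr hf
  let N := max N₀ (x + 1)
  have hx : x < N := by omega
  have hS := (Formula.isSemilinearSet_holds a N hf).image (Pi.evalAddMonoidHom _ ⟨x, hx⟩)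
  obtain ⟨k, p, hp, h⟩ := Nat.isSemilinearSet_iff_ultimately_periodic.1 hS
  have hmem (m : ℕ) : List.replicate m a ∈ f.expressed x ↔
      m ∈ Pi.evalAddMonoidHom _ ⟨x, hx⟩ '' {n : Fin N → ℕ | f.Holds (powerSubst a n)} := by
    constructor
    · rintro ⟨h, hh, hm⟩
      refine ⟨fun i => (h i).length, ?_, ?_⟩
      · refine (hN₀ h _ fun i hi => ?_).1 hh
        have hi' : i < N := by omega
        rw [powerSubst, dif_pos hi']
        exact eq_replicate_of_subsingleton a (h i)
      · change (h x).length = m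
        rw [hm, List.length_replicate]
    · rintro ⟨n, hn, rfl⟩
      refine ⟨powerSubst a n, hn, ?_⟩
      rw [powerSubst, dif_pos hx]
      rfl
  exact ⟨k, p, hp, fun m hm => by rw [hmem, hmem]; exact h m hm⟩

/-- Replacing all `c` occurrences of `v` by a word that is shorter by `p` shortens the word by
`c * p`. -/
theorem length_replaceFactor_add [DecidableEq α] (ws : List (List α)) {v u : List α} {p : ℕ}
    (h : u.length + p = v.length) :
    (replaceFactor ws v u).length + ws.count v * p = ws.flatten.length := by
  induction ws with
  | nil => simp [replaceFactor]
  | cons w ws ih =>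
    rw [← List.singleton_append, replaceFactor_append, List.length_append, List.flatten_append,
      List.length_append, ← ih, List.count_append, add_mul]
    by_cases hw : w = v
    · subst hw
      simp [replaceFactor, ← h]
      omega
    · simp [replaceFactor, hw]
      omega

theorem length_le_length_replaceFactor [DecidableEq α] {ws : List (List α)} {v v' : List α}
    (hv' : v' ∈ ws) (hne : v' ≠ v) (u : List α) :
    v'.length ≤ (replaceFactor ws v u).length := by
  have hmem : v' ∈ ws.map fun z => if z = v then u else z :=
    List.mem_map.2 ⟨v', hv', if_neg hne⟩
  exact (List.sublist_flatten_of_mem hmem).length_le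

theorem Formula.wereg_of_subsingleton [Subsingleton α] [DecidableEq α]
    (𝔽 : List (List α) → Prop) {f : Formula α} (hf : f.IsWEREG) (x : ℕ) :
    ∃ d e : ℕ, ∀ w ∈ f.expressed x, ∀ ws, IsFactorisation 𝔽 w ws →
      d < (ws.toFinset.filter (fun v => e < v.length)).card →
      ∃ v ∈ ws, e < v.length ∧ ∃ u : List α, u.length < v.length ∧
        replaceFactor ws v u ∈ f.expressed x := by
  rcases isEmpty_or_nonempty α with hα | ⟨⟨a⟩⟩
  · refine ⟨0, 0, fun w _ ws _ hcard => ?_⟩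
    obtain ⟨v, hv⟩ := Finset.card_pos.1 hcard
    rw [Finset.mem_filter, Subsingleton.elim v []] at hv
    simp at hv
  obtain ⟨k, p, hp, hper⟩ := Formula.exists_period a hf x
  -- Two long factors are needed: the second one keeps the new word above the threshold `k`.
  refine ⟨1, k + p, fun w hw ws hws hcard => ?_⟩
  obtain ⟨v, hv, v', hv', hne⟩ := Finset.one_lt_card.1 hcard
  simp only [Finset.mem_filter, List.mem_toFinset] at hv hv'
  refine ⟨v, hv.1, hv.2, List.replicate (v.length - p) a, ?_, ?_⟩
  · rw [List.length_replicate]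
    omega
  have hlen := length_replaceFactor_add ws (v := v) (u := List.replicate (v.length - p) a) (p := p)
    (by rw [List.length_replicate]; omega)
  have hle := length_le_length_replaceFactor hv'.1 hne.symm (List.replicate (v.length - p) a)
  have hiter (c m : ℕ) (hm : k ≤ m) : List.replicate m a ∈ f.expressed x ↔
      List.replicate (m + c * p) a ∈ f.expressed x := by
    induction c with
    | zero => simp
    | succ c ih => rw [ih, hper _ (by omega), add_mul, one_mul, add_assoc]
  rw [eq_replicate_of_subsingleton a (replaceFactor _ _ _), hiter (ws.count v) _ (by omega), hlen,
    ← eq_replicate_of_subsingleton, hws.2.1]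
  exact hw

theorem Formula.welen_of_subsingleton [Subsingleton α] [DecidableEq α]
    (𝔽 : List (List α) → Prop) (f : Formula α) (x : ℕ) :
    ∃ d : ℕ, ∀ w ∈ f.expressed x, ∀ ws, IsFactorisation 𝔽 w ws → d < ws.toFinset.card →
      ∃ v ∈ ws, ∀ u : List α, u.length = v.length → replaceFactor ws v u ∈ f.expressed x := by
  refine ⟨0, fun w hw ws hws hcard => ?_⟩
  obtain ⟨v, hv⟩ := Finset.card_pos.1 hcard
  refine ⟨v, List.mem_toFinset.1 hv, fun u hu => ?_⟩
  -- Words of equal length are equal here, so the replacement changes nothing.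
  have huv : replaceFactor ws v u = w :=
    List.ext_getElem (by rw [length_replaceFactor ws hu, hws.2.1])
      fun _ _ _ => Subsingleton.elim _ _
  rwa [huv]

end

end WordTheory

theorem mainTheorem4 {α : Type*} [Fintype α] [DecidableEq α]
    (𝔽 : List (List α) → Prop) (h𝔽 : WordTheory.IsSynchronising 𝔽)
    (f : WordTheory.Formula α) (x : ℕ) :
    (f.IsWELEN →
      ∃ d : ℕ, ∀ w ∈ f.expressed x, ∀ ws : List (List α), WordTheory.IsFactorisation 𝔽 w ws →
        d < ws.toFinset.card →
        ∃ v ∈ ws, ∀ u : List α, u.length = v.length →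
          WordTheory.replaceFactor ws v u ∈ f.expressed x) ∧
    (f.IsWEREG →
      ∃ d e : ℕ, ∀ w ∈ f.expressed x, ∀ ws : List (List α), WordTheory.IsFactorisation 𝔽 w ws →
        d < (ws.toFinset.filter (fun v => e < v.length)).card →
        ∃ v ∈ ws, e < v.length ∧ ∃ u : List α, u.length < v.length ∧
          WordTheory.replaceFactor ws v u ∈ f.expressed x) := by
  rcases subsingleton_or_nontrivial α with hα | hα
  · exact ⟨fun _ => WordTheory.Formula.welen_of_subsingleton 𝔽 f x,
      fun hf => WordTheory.Formula.wereg_of_subsingleton 𝔽 hf x⟩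
  · exact ⟨fun hf => h𝔽.welen_of_nontrivial hf x, fun hf => h𝔽.wereg_of_nontrivial hf x⟩
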